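/- Let $N$ be a (non-empty, Hausdorff, second countable, not necessarily compact) smooth manifold without boundary of dimension $n \ge 2$, and let $T^*N$ be its cotangent bundle with its canonical symplectic form $\omega = d\lambda$, where $\lambda_{(q,p)}(v) = p(d\pi\, v)$ and $\pi : T^*N \to N$ is the projection. Let $\mathrm{Ham}$ be the set of smooth paths $H = (H_t)_{t\in[0,1]}$ of functions on $T^*N$ (with no condition on supports) whose symplectic gradients $X_{H_t}$, defined by $dH_t = \iota_{X_{H_t}}\omega$, generate an isotopy $(\phi_H^t)_{t \in [0,1]}$ of diffeomorphisms of $T^*N$ with $\phi_H^0 = \mathrm{Id}$, and let $\mathrm{Ham}$ carry the compact-open topology of functions on $[0,1]\times T^*N$. Let $\Phi(H) = \phi_H^1$, and let $\mathcal{H}(T^*N) = \Phi(\mathrm{Ham})$ be the group of Hamiltonian diffeomorphisms of $T^*N$. Then there is no $C^{-1}$ bi-invariant metric on $\mathcal{H}(T^*N)$, i.e. there is no distance $d$ on $\mathcal{H}(T^*N)$ such that $$d(\phi,\psi) = d(\phi\chi,\psi\chi) = d(\chi\phi,\chi\psi) \quad\text{for all } \phi,\psi,\chi \in \mathcal{H}(T^*N)$$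 and such that the map $\mathrm{Ham}\times\mathrm{Ham} \to \mathbb{R}$, $(H,K) \mapsto d(\Phi(H),\Phi(K))$, is continuous. -/

import Mathlib

open Set Function
open scoped Manifold ContDiff Topology

noncomputable section

namespace HamiltonianGeometry

section Manifold

variable {E : Type*} [NormedAddCommGroup E] [NormedSpace ℝ E]
  {H : Type*} [TopologicalSpace H] (I : ModelWithCorners ℝ E H)
  {M : Type*} [TopologicalSpace M] [ChartedSpace H M]

/-- The expression of a `1`-form `θ` on `M` in the preferred chart around `x₀`, i.e. the pull-back
of `θ` by the inverse of that chart, a `1`-form on (the target of the chart in) the model space. -/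
def oneFormInChart (θ : ∀ x : M, TangentSpace I x →L[ℝ] ℝ) (x₀ : M) (y : E) : E →L[ℝ] ℝ :=
  (θ ((extChartAt I x₀).symm y)).comp
    (mfderivWithin 𝓘(ℝ, E) I (extChartAt I x₀).symm (range I) y)

/-- The exterior derivative `dθ` of a `1`-form `θ` on `M`: in the preferred chart around `x`,
`dθ(v, w) = (D_v θ)(w) - (D_w θ)(v)`. -/
def extDerivOneForm (θ : ∀ x : M, TangentSpace I x →L[ℝ] ℝ) (x : M)
    (v w : TangentSpace I x) : ℝ :=
  let D : E →L[ℝ] E →L[ℝ] ℝ :=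
    fderivWithin ℝ (oneFormInChart I θ x) (range I) (extChartAt I x x)
  let v' : E := mfderiv I 𝓘(ℝ, E) (extChartAt I x) x v
  let w' : E := mfderiv I 𝓘(ℝ, E) (extChartAt I x) x w
  D v' w' - D w' v'

variable {I}

/-- `V` is the value at `x` of the symplectic gradient of `f` with respect to `Ω`, i.e.
`df = ι_V Ω` at the point `x`. -/
def IsSymplecticGradientAt (Ω : ∀ x : M, TangentSpace I x → TangentSpace I x → ℝ)
    (f : M → ℝ) (x : M) (V : TangentSpace I x) : Prop :=
  ∀ w : TangentSpace I x, (mfderiv I 𝓘(ℝ, ℝ) f x w : ℝ) = Ω x V w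

variable (Ω : ∀ x : M, TangentSpace I x → TangentSpace I x → ℝ)

/-- The set `Ham` of the smooth paths `(H_t)`, `t ∈ [0, 1]`, of Hamiltonian functions on `(M, Ω)`
whose flow exists for all times `t ∈ [0, 1]`. The isotopy `φ_t` is uniquely determined by `H`, and
is recorded for convenience; there is no condition on supports. The values of `H` and of `flow` at
times outside `[0, 1]` are irrelevant. -/
structure HamiltonianPath where
  /-- the Hamiltonian functions `H_t` -/
  ham : ℝ → M → ℝ
  smooth_ham : ContMDiffOn (𝓘(ℝ, ℝ).prod I) 𝓘(ℝ, ℝ) ∞ (uncurry ham) (Icc 0 1 ×ˢ univ)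
  /-- the flow `φ_t` -/
  flow : ℝ → (M ≃ₘ⟮I, I⟯ M)
  flow_zero : ∀ x, flow 0 x = x
  hamilton : ∀ t ∈ Icc (0 : ℝ) 1, ∀ x : M, ∃ V : TangentSpace I (flow t x),
    IsSymplecticGradientAt Ω (ham t) (flow t x) V ∧
      HasMFDerivWithinAt 𝓘(ℝ, ℝ) I (fun s ↦ flow s x) (Icc 0 1) t
        ((1 : ℝ →L[ℝ] ℝ).smulRight V)

namespace HamiltonianPath

variable {Ω}

/-- A path of Hamiltonian functions as a continuous function on `[0, 1] × M`. -/
def toContinuousMap (h : HamiltonianPath Ω) : C(unitInterval × M, ℝ) where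
  toFun p := h.ham p.1 p.2
  continuous_toFun :=
    h.smooth_ham.continuousOn.comp_continuous
      (f := fun p : unitInterval × M ↦ ((p.1 : ℝ), p.2)) (by fun_prop)
      (fun p ↦ ⟨p.1.2, mem_univ _⟩)

/-- The compact-open topology on the set of Hamiltonians. -/
instance : TopologicalSpace (HamiltonianPath Ω) :=
  TopologicalSpace.induced toContinuousMap ContinuousMap.compactOpen

/-- The map `Φ : H ↦ φ_H^1`. -/
def timeOne (h : HamiltonianPath Ω) : M ≃ₘ⟮I, I⟯ M := h.flow 1

end HamiltonianPath

/-- The group `ℋ(M)` of Hamiltonian diffeomorphisms of `(M, Ω)`. -/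
def hamiltonianDiffeos : Set (M ≃ₘ⟮I, I⟯ M) :=
  range (HamiltonianPath.timeOne (Ω := Ω))

/-- `d` is a bi-invariant metric on the group `G` of diffeomorphisms of `M`: a distance on `G` such
that `d(φ, ψ) = d(φχ, ψχ) = d(χφ, χψ)` for all `φ, ψ, χ ∈ G`. The products are named by elements of
`G`, here `φ' = φχ`, `ψ' = ψχ`, respectively `φ' = χφ`, `ψ' = χψ`. -/
structure IsBiinvariantMetric (G : Set (M ≃ₘ⟮I, I⟯ M)) (d : G → G → ℝ) : Prop where
  eq_zero_iff : ∀ φ ψ : G, d φ ψ = 0 ↔ φ = ψ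
  symm : ∀ φ ψ : G, d φ ψ = d ψ φ
  triangle : ∀ φ ψ χ : G, d φ χ ≤ d φ ψ + d ψ χ
  right_invariant : ∀ φ ψ χ φ' ψ' : G,
    (∀ x, φ'.1 x = φ.1 (χ.1 x)) → (∀ x, ψ'.1 x = ψ.1 (χ.1 x)) → d φ ψ = d φ' ψ'
  left_invariant : ∀ φ ψ χ φ' ψ' : G,
    (∀ x, φ'.1 x = χ.1 (φ.1 x)) → (∀ x, ψ'.1 x = χ.1 (ψ.1 x)) → d φ ψ = d φ' ψ'

/-- The metric `d` on `G` is `C⁻¹`: its composition with `Φ : H ↦ φ_H^1` is continuous on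
`Φ⁻¹(G) × Φ⁻¹(G)`, where `Φ⁻¹(G)` carries the compact-open topology. -/
def IsCMinusOne (G : Set (M ≃ₘ⟮I, I⟯ M)) (d : G → G → ℝ) : Prop :=
  Continuous fun p : {h : HamiltonianPath Ω // h.timeOne ∈ G} ×
      {h : HamiltonianPath Ω // h.timeOne ∈ G} ↦
    d ⟨p.1.1.timeOne, p.1.2⟩ ⟨p.2.1.timeOne, p.2.2⟩

end Manifold

section Cotangent

variable (n : ℕ) (N : Type*) [TopologicalSpace N] [ChartedSpace (EuclideanSpace ℝ (Fin n)) N]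

/-- The cotangent bundle `T*N` of an `n`-dimensional manifold `N`. -/
abbrev CotangentBundle : Type _ :=
  Bundle.TotalSpace (EuclideanSpace ℝ (Fin n) →L[ℝ] ℝ)
    (fun q : N ↦ TangentSpace (𝓡 n) q →L[ℝ] ℝ)

/-- The model with corners (without boundary) of `T*N`. -/
abbrev cotangentModel : ModelWithCorners ℝ
    (EuclideanSpace ℝ (Fin n) × (EuclideanSpace ℝ (Fin n) →L[ℝ] ℝ))
    (ModelProd (EuclideanSpace ℝ (Fin n)) (EuclideanSpace ℝ (Fin n) →L[ℝ] ℝ)) :=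
  (𝓡 n).prod 𝓘(ℝ, EuclideanSpace ℝ (Fin n) →L[ℝ] ℝ)

variable [IsManifold (𝓡 n) ∞ N]

/-- The Liouville form `λ = p dq` of `T*N`: `λ_{(q, p)}(v) = p(dπ v)`, with `π : T*N → N` the
projection. -/
def liouvilleForm (x : CotangentBundle n N) : TangentSpace (cotangentModel n) x →L[ℝ] ℝ :=
  x.2.comp (mfderiv (cotangentModel n) (𝓡 n) (fun z : CotangentBundle n N ↦ z.1) x)

/-- The canonical symplectic form `ω = dλ = dp ∧ dq` of `T*N`. -/
def canonicalForm (x : CotangentBundle n N) (v w : TangentSpace (cotangentModel n) x) : ℝ :=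
  extDerivOneForm (cotangentModel n) (liouvilleForm n N) x v w

/-- The group `ℋ(T*N)` of Hamiltonian diffeomorphisms of `T*N`, without condition on supports. -/
abbrev cotangentHamiltonianDiffeos :
    Set (CotangentBundle n N ≃ₘ⟮cotangentModel n, cotangentModel n⟯ CotangentBundle n N) :=
  hamiltonianDiffeos (canonicalForm n N)

end Cotangent

end HamiltonianGeometry

end

/-!
If a Hamiltonian `H` generates `φ` and `χ` is a Hamiltonian diffeomorphism, a bi-invariant metric
`d` satisfies `d(id, φ) = d(id, χ φ χ⁻¹)`, and `χ φ χ⁻¹` is generated by `H ∘ χ⁻¹`. On a cotangent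
bundle the support of `H` can be pushed to infinity by fibrewise translations: if `f` is a function
on the base with `df ≠ 0` on the projection of the support of `H`, then
`χ_k (q, p) = (q, p + k df(q))` is generated by `k f`, and the Hamiltonians `H ∘ χ_k⁻¹` vanish
eventually on each compact set. So they converge to zero in the compact-open topology, continuity
gives `d(id, φ) = d(id, id) = 0`, and hence `φ = id`. It remains to exhibit some such `φ ≠ id`.

No flow has to be found by integrating a vector field. In a chart of `N` around a point `q₀`, which
gives a chart of `T*N` with values in `E × E*`, where `E = ℝⁿ`, the Hamiltonian is
`h (|q - q₀|² + |p|²)`. Its flow rotates `(q - q₀) + i p` with angular velocity `2 h'`, which is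
constant along the orbits (`SupportedFlow.rotation`). The function `f` is linear near the projection
of the support, with differential `c`, so conjugation by `χ_k` just moves the centre of this
rotation from `(q₀, 0)` to `(q₀, k c)` (`SupportedFlow.translate_rotation`). The product of `χ_k`
with the rotation has to be Hamiltonian as well; its explicit time-dependent Hamiltonian is given in
`SupportedFlow.translate`.

The transfer from the chart to `T*N` (`SupportedFlow.toHamiltonianPath`) needs that the canonical
form, which is defined at each point by the preferred chart there, is `dp ∧ dq` in every chart of
the cotangent bundle (`canonicalForm_eq_stdForm`). This holds because the Liouville form is `p dq`
in each of them (`oneFormInChart_liouvilleForm`), so that changes of charts preserve `p dq`, and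
therefore also its exterior derivative.
-/

namespace HamiltonianGeometry

/-! ### The standard symplectic form -/

section Standard

variable {E : Type*} [NormedAddCommGroup E] [NormedSpace ℝ E]

variable (E) in
/-- The Liouville form `p dq` of `E × E*`, as a continuous linear map in the base point. -/
noncomputable def stdLiouville : (E × (E →L[ℝ] ℝ)) →L[ℝ] (E × (E →L[ℝ] ℝ)) →L[ℝ] ℝ :=
  ((ContinuousLinearMap.compL ℝ (E × (E →L[ℝ] ℝ)) E ℝ).flip
    (ContinuousLinearMap.fst ℝ _ _)).comp (ContinuousLinearMap.snd ℝ _ _)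

/-- The standard symplectic form `dp ∧ dq` of `E × E*`. -/
def stdForm (v w : E × (E →L[ℝ] ℝ)) : ℝ := v.2 w.1 - w.2 v.1

/-- A map which preserves a one-form `L` whose coefficients are linear in the base point preserves
its exterior derivative, since second derivatives are symmetric. -/
lemma antisymm_fderiv_of_preserves {V : Type*} [NormedAddCommGroup V] [NormedSpace ℝ V]
    (L : V →L[ℝ] V →L[ℝ] ℝ) {T : V → V} {y : V} (hT : ContDiffAt ℝ 2 T y)
    (h : ∀ᶠ z in 𝓝 y, (L (T z)).comp (fderiv ℝ T z) = L z) (v w : V) :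
    L (fderiv ℝ T y v) (fderiv ℝ T y w) - L (fderiv ℝ T y w) (fderiv ℝ T y v) =
      L v w - L w v := by
  have hT' : HasFDerivAt T (fderiv ℝ T y) y := (hT.differentiableAt (by norm_num)).hasFDerivAt
  have hT'' : HasFDerivAt (fderiv ℝ T) (fderiv ℝ (fderiv ℝ T) y) y :=
    ((hT.fderiv_right (m := 1) (by norm_num)).differentiableAt (by norm_num)).hasFDerivAt
  have hsymm : fderiv ℝ (fderiv ℝ T) y v w = fderiv ℝ (fderiv ℝ T) y w v :=
    (hT.isSymmSndFDerivAt (by simp)).eq v w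
  have hL : HasFDerivAt (fun z ↦ L (T z)) (L.comp (fderiv ℝ T y)) y := L.hasFDerivAt.comp y hT'
  have h1 := (hL.clm_comp hT'').congr_of_eventuallyEq (Filter.EventuallyEq.symm h)
  have h2 := h1.unique L.hasFDerivAt
  have hv := congr($h2 v w)
  have hw := congr($h2 w v)
  simp only [add_apply, ContinuousLinearMap.comp_apply, ContinuousLinearMap.flip_apply,
    ContinuousLinearMap.compL_apply] at hv hw
  rw [← hv, ← hw, hsymm]
  ring

/-- A map which preserves `p dq` preserves `dp ∧ dq`. -/
lemma stdForm_fderiv_of_preserves {T : E × (E →L[ℝ] ℝ) → E × (E →L[ℝ] ℝ)} {y : E × (E →L[ℝ] ℝ)}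
    (hT : ContDiffAt ℝ 2 T y)
    (h : ∀ᶠ z in 𝓝 y, (stdLiouville E (T z)).comp (fderiv ℝ T z) = stdLiouville E z)
    (v w : E × (E →L[ℝ] ℝ)) : stdForm (fderiv ℝ T y v) (fderiv ℝ T y w) = stdForm v w :=
  antisymm_fderiv_of_preserves (stdLiouville E) hT h v w

end Standard

/-- The model `ℝⁿ × (ℝⁿ)*` of the cotangent bundle of an `n`-dimensional manifold. -/
abbrev PhaseSpace (n : ℕ) : Type :=
  EuclideanSpace ℝ (Fin n) × (EuclideanSpace ℝ (Fin n) →L[ℝ] ℝ)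

/-! ### Changes of charts -/

section Transition

variable {E H M : Type*} [NormedAddCommGroup E] [NormedSpace ℝ E] [TopologicalSpace H]
  {I : ModelWithCorners ℝ E H} [I.Boundaryless] [TopologicalSpace M] [ChartedSpace H M]

lemma mdifferentiableAt_extChartAt_symm_of_boundaryless [IsManifold I 1 M] {x : M} {y : E}
    (hy : y ∈ (extChartAt I x).target) :
    MDifferentiableAt 𝓘(ℝ, E) I (extChartAt I x).symm y := by
  have := mdifferentiableWithinAt_extChartAt_symm hy
  rwa [I.range_eq_univ, mdifferentiableWithinAt_univ] at this

lemma fderiv_extChartAt_transition [IsManifold I 1 M] {x₀ x : M} {z : E}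
    (hz : z ∈ (extChartAt I x₀).target)
    (hz' : (extChartAt I x₀).symm z ∈ (extChartAt I x).source) :
    fderiv ℝ (extChartAt I x ∘ (extChartAt I x₀).symm) z =
      (mfderiv I 𝓘(ℝ, E) (extChartAt I x) ((extChartAt I x₀).symm z)).comp
        (mfderiv 𝓘(ℝ, E) I (extChartAt I x₀).symm z) := by
  rw [← mfderiv_eq_fderiv, mfderiv_comp z
    (mdifferentiableAt_extChartAt (by rwa [← extChartAt_source I]))
    (mdifferentiableAt_extChartAt_symm_of_boundaryless hz)]

/-- The expressions of a one-form in two charts are pulled back to each other by the change of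
charts. -/
lemma oneFormInChart_transition [IsManifold I 1 M] (θ : ∀ x : M, TangentSpace I x →L[ℝ] ℝ)
    {x₀ x : M} {z : E} (hz : z ∈ (extChartAt I x₀).target)
    (hz' : (extChartAt I x₀).symm z ∈ (extChartAt I x).source) :
    (oneFormInChart I θ x (extChartAt I x ((extChartAt I x₀).symm z))).comp
      (fderiv ℝ (extChartAt I x ∘ (extChartAt I x₀).symm) z) = oneFormInChart I θ x₀ z := by
  have hid := mfderivWithin_extChartAt_symm_comp_mfderiv_extChartAt' hz'
  rw [fderiv_extChartAt_transition hz hz']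
  unfold oneFormInChart
  rw [(extChartAt I x).left_inv hz']
  rw [I.range_eq_univ, mfderivWithin_univ] at *
  rw [mfderivWithin_univ]
  refine ContinuousLinearMap.ext fun u ↦ ?_
  exact congr(θ ((extChartAt I x₀).symm z) ($hid (mfderiv 𝓘(ℝ, E) I (extChartAt I x₀).symm z u)))

lemma mfderiv_extChartAt_transition [IsManifold I 1 M] {x₀ x : M}
    (hx : x ∈ (extChartAt I x₀).source) (u : TangentSpace I x) :
    mfderiv I 𝓘(ℝ, E) (extChartAt I x) x u =
      fderiv ℝ (extChartAt I x ∘ (extChartAt I x₀).symm) (extChartAt I x₀ x)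
        (mfderiv I 𝓘(ℝ, E) (extChartAt I x₀) x u) := by
  have hid := mfderivWithin_extChartAt_symm_comp_mfderiv_extChartAt' hx
  rw [I.range_eq_univ, mfderivWithin_univ] at hid
  rw [fderiv_extChartAt_transition ((extChartAt I x₀).map_source hx)
    (by rw [(extChartAt I x₀).left_inv hx]; exact mem_extChartAt_source x),
    (extChartAt I x₀).left_inv hx]
  exact congr(mfderiv I 𝓘(ℝ, E) (extChartAt I x) x ($hid u)).symm

lemma contDiffAt_extChartAt_transition [IsManifold I ∞ M] {x₀ x : M}
    (hx : x ∈ (extChartAt I x₀).source) :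
    ContDiffAt ℝ 2 (extChartAt I x ∘ (extChartAt I x₀).symm) (extChartAt I x₀ x) := by
  have hyt := (extChartAt I x₀).map_source hx
  have h1 : ContMDiffAt 𝓘(ℝ, E) I ∞ (extChartAt I x₀).symm (extChartAt I x₀ x) :=
    (contMDiffOn_extChartAt_symm x₀).contMDiffAt ((isOpen_extChartAt_target x₀).mem_nhds hyt)
  have h2 : ContMDiffAt I 𝓘(ℝ, E) ∞ (extChartAt I x)
      ((extChartAt I x₀).symm (extChartAt I x₀ x)) := by
    rw [(extChartAt I x₀).left_inv hx]
    exact contMDiffAt_extChartAt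
  exact contDiffAt_infty.1 (h2.comp _ h1).contDiffAt 2

lemma eventually_extChartAt_transition {x₀ x : M} (hx : x ∈ (extChartAt I x₀).source) :
    ∀ᶠ z in 𝓝 (extChartAt I x₀ x),
      z ∈ (extChartAt I x₀).target ∧ (extChartAt I x₀).symm z ∈ (extChartAt I x).source := by
  have hyt := (extChartAt I x₀).map_source hx
  refine ((isOpen_extChartAt_target x₀).mem_nhds hyt |> Filter.Eventually.and) ?_
  refine (continuousAt_extChartAt_symm'' hyt).eventually_mem ?_
  rw [(extChartAt I x₀).left_inv hx]
  exact extChartAt_source_mem_nhds x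

end Transition

/-! ### The canonical symplectic form in charts -/

section Chart

variable {n : ℕ} {N : Type*} [TopologicalSpace N] [ChartedSpace (EuclideanSpace ℝ (Fin n)) N]
  [IsManifold (𝓡 n) ∞ N]

lemma extChartAt_cotangent_source (x : CotangentBundle n N) :
    (extChartAt (cotangentModel n) x).source =
      Bundle.TotalSpace.proj ⁻¹' (extChartAt (𝓡 n) x.proj).source := by
  rw [FiberBundle.extChartAt]
  simp
  exact fun y hy ↦ ⟨hy, mem_univ _⟩

lemma extChartAt_cotangent_target (x : CotangentBundle n N) :
    (extChartAt (cotangentModel n) x).target = (extChartAt (𝓡 n) x.proj).target ×ˢ univ := by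
  rw [FiberBundle.extChartAt_target]
  simp
  exact fun y hy ↦ (chartAt (EuclideanSpace ℝ (Fin n)) x.proj).map_target hy

/-- The momentum of a covector in a chart is its pull-back by the inverse of the base chart. -/
lemma extChartAt_cotangent_apply {x y : CotangentBundle n N}
    (hy : y.proj ∈ (chartAt (EuclideanSpace ℝ (Fin n)) x.proj).source) :
    extChartAt (cotangentModel n) x y =
      (extChartAt (𝓡 n) x.proj y.proj, y.2.comp (mfderivWithin 𝓘(ℝ, EuclideanSpace ℝ (Fin n))
        (𝓡 n) (extChartAt (𝓡 n) x.proj).symm (range (𝓡 n))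
        (extChartAt (𝓡 n) x.proj y.proj))) := by
  rw [← TangentBundle.symmL_trivializationAt hy, FiberBundle.extChartAt]
  simp
  refine Prod.ext rfl (ContinuousLinearMap.ext fun v ↦ ?_)
  simp [hom_trivializationAt_apply, ContinuousLinearMap.inCoordinates]
  rfl

lemma extChartAt_cotangent_apply_fst (x y : CotangentBundle n N) :
    (extChartAt (cotangentModel n) x y).1 = extChartAt (𝓡 n) x.proj y.proj := by
  rw [FiberBundle.extChartAt]
  simp
  rfl

lemma proj_extChartAt_cotangent_symm {x : CotangentBundle n N} {y : PhaseSpace n}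
    (hy : y ∈ (extChartAt (cotangentModel n) x).target) :
    ((extChartAt (cotangentModel n) x).symm y).proj = (extChartAt (𝓡 n) x.proj).symm y.1 := by
  have h := (extChartAt (cotangentModel n) x).map_target hy
  rw [extChartAt_cotangent_source] at h
  rw [← (extChartAt (𝓡 n) x.proj).left_inv h, ← extChartAt_cotangent_apply_fst,
    (extChartAt (cotangentModel n) x).right_inv hy]

/-- The Liouville form is `p dq` in every chart of the cotangent bundle. -/
lemma oneFormInChart_liouvilleForm {x : CotangentBundle n N} {y : PhaseSpace n}
    (hy : y ∈ (extChartAt (cotangentModel n) x).target) :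
    oneFormInChart (cotangentModel n) (liouvilleForm n N) x y =
      stdLiouville (EuclideanSpace ℝ (Fin n)) y := by
  have hy1 : y.1 ∈ (extChartAt (𝓡 n) x.proj).target := by
    rw [extChartAt_cotangent_target] at hy
    exact hy.1
  set z := (extChartAt (cotangentModel n) x).symm y with hz
  have hzs : z ∈ (extChartAt (cotangentModel n) x).source :=
    (extChartAt (cotangentModel n) x).map_target hy
  have hzs' : z.proj ∈ (chartAt (EuclideanSpace ℝ (Fin n)) x.proj).source := by
    rw [extChartAt_cotangent_source] at hzs
    simpa using hzs
  have hyz : extChartAt (cotangentModel n) x z = y :=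
    (extChartAt (cotangentModel n) x).right_inv hy
  have h2 := extChartAt_cotangent_apply hzs'
  have h1 : extChartAt (𝓡 n) x.proj z.proj = y.1 := by
    rw [← extChartAt_cotangent_apply_fst, hyz]
  rw [hyz, h1, (𝓡 n).range_eq_univ, mfderivWithin_univ] at h2
  have hproj : MDifferentiableAt (cotangentModel n) (𝓡 n)
      (fun z : CotangentBundle n N ↦ z.1) z :=
    ((Bundle.contMDiff_proj (n := ∞) (IB := 𝓡 n)
      (fun q : N ↦ TangentSpace (𝓡 n) q →L[ℝ] ℝ)) z).mdifferentiableAt (by simp)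
  have hcomp : (mfderiv (cotangentModel n) (𝓡 n) (fun z : CotangentBundle n N ↦ z.1) z).comp
      (mfderiv 𝓘(ℝ, PhaseSpace n) (cotangentModel n) (extChartAt (cotangentModel n) x).symm y) =
      (mfderiv 𝓘(ℝ, EuclideanSpace ℝ (Fin n)) (𝓡 n) (extChartAt (𝓡 n) x.proj).symm y.1).comp
        (ContinuousLinearMap.fst ℝ _ _) := by
    rw [← mfderiv_comp y hproj (mdifferentiableAt_extChartAt_symm_of_boundaryless hy)]
    have hev : (fun z : CotangentBundle n N ↦ z.1) ∘ (extChartAt (cotangentModel n) x).symm =ᶠ[𝓝 y]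
        (extChartAt (𝓡 n) x.proj).symm ∘ Prod.fst := by
      filter_upwards [(isOpen_extChartAt_target x).mem_nhds hy] with w hw
      exact proj_extChartAt_cotangent_symm hw
    rw [hev.mfderiv_eq, mfderiv_comp (I' := 𝓘(ℝ, EuclideanSpace ℝ (Fin n))) y
      (mdifferentiableAt_extChartAt_symm_of_boundaryless hy1)
      (differentiableAt_fst.mdifferentiableAt), mfderiv_eq_fderiv, fderiv_fst]
    rfl
  unfold oneFormInChart liouvilleForm
  rw [(cotangentModel n).range_eq_univ, mfderivWithin_univ, ← hz]
  have h3 := congr(Prod.snd $h2)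
  refine ContinuousLinearMap.ext fun v ↦ ?_
  have h4 := congr($h3 v.1)
  have h5 := congr(z.2 ($hcomp v))
  exact h5.trans h4.symm

/-- The canonical form at `x` is `dp ∧ dq` in the preferred chart at `x`, where it is defined. -/
lemma canonicalForm_eq_stdForm_self (x : CotangentBundle n N)
    (v w : TangentSpace (cotangentModel n) x) :
    canonicalForm n N x v w =
      stdForm (mfderiv (cotangentModel n) 𝓘(ℝ, PhaseSpace n) (extChartAt (cotangentModel n) x) x v)
        (mfderiv (cotangentModel n) 𝓘(ℝ, PhaseSpace n)
          (extChartAt (cotangentModel n) x) x w) := by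
  have hev : oneFormInChart (cotangentModel n) (liouvilleForm n N) x
      =ᶠ[𝓝 (extChartAt (cotangentModel n) x x)] stdLiouville (EuclideanSpace ℝ (Fin n)) := by
    filter_upwards [extChartAt_target_mem_nhds x] with y hy
    exact oneFormInChart_liouvilleForm hy
  unfold canonicalForm extDerivOneForm
  rw [(cotangentModel n).range_eq_univ, fderivWithin_univ, hev.fderiv_eq]
  have hL : fderiv ℝ (stdLiouville (EuclideanSpace ℝ (Fin n)))
      (extChartAt (cotangentModel n) x x) =
      stdLiouville (EuclideanSpace ℝ (Fin n)) := ContinuousLinearMap.fderiv _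
  have (D : PhaseSpace n →L[ℝ] PhaseSpace n →L[ℝ] ℝ)
      (hD : D = stdLiouville (EuclideanSpace ℝ (Fin n))) (v w : PhaseSpace n) :
      D v w - D w v = stdForm v w := by
    rw [hD]
    rfl
  exact this _ hL _ _

/-- The canonical form is `dp ∧ dq` in every chart of the cotangent bundle. -/
lemma canonicalForm_eq_stdForm {x₀ x : CotangentBundle n N}
    (hx : x ∈ (extChartAt (cotangentModel n) x₀).source)
    (v w : TangentSpace (cotangentModel n) x) :
    canonicalForm n N x v w =
      stdForm (mfderiv (cotangentModel n) 𝓘(ℝ, PhaseSpace n) (extChartAt (cotangentModel n) x₀) x v)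
        (mfderiv (cotangentModel n) 𝓘(ℝ, PhaseSpace n)
          (extChartAt (cotangentModel n) x₀) x w) := by
  rw [canonicalForm_eq_stdForm_self, mfderiv_extChartAt_transition hx v,
    mfderiv_extChartAt_transition hx w]
  refine stdForm_fderiv_of_preserves (contDiffAt_extChartAt_transition hx) ?_ _ _
  filter_upwards [eventually_extChartAt_transition hx] with z hz
  rw [← oneFormInChart_liouvilleForm hz.1, comp_apply,
    ← oneFormInChart_liouvilleForm ((extChartAt (cotangentModel n) x).map_source hz.2)]
  exact oneFormInChart_transition _ hz.1 hz.2

end Chart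

/-! ### Extension of maps supported in a chart -/

section ExtendMap

variable {E H M : Type*} [NormedAddCommGroup E] [NormedSpace ℝ E] [TopologicalSpace H]
  (I : ModelWithCorners ℝ E H) [TopologicalSpace M] [ChartedSpace H M]

open Classical in
/-- The self-map of `M` which is `ρ` in the chart around `x₀`, and the identity outside of the
domain of this chart. -/
noncomputable def chartExtendMap (x₀ : M) (ρ : E → E) (x : M) : M :=
  if x ∈ (extChartAt I x₀).source then (extChartAt I x₀).symm (ρ (extChartAt I x₀ x)) else x

open Classical in
/-- The function on `M` which is `K` in the chart around `x₀`, and zero outside of the domain of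
this chart. -/
noncomputable def chartExtendFun (x₀ : M) (K : E → ℝ) (x : M) : ℝ :=
  if x ∈ (extChartAt I x₀).source then K (extChartAt I x₀ x) else 0

variable {I} {x₀ x : M} {ρ : E → E} {K : E → ℝ} {A : Set M}

lemma chartExtendMap_of_mem (hx : x ∈ (extChartAt I x₀).source) :
    chartExtendMap I x₀ ρ x = (extChartAt I x₀).symm (ρ (extChartAt I x₀ x)) := if_pos hx

lemma chartExtendMap_of_notMem (hx : x ∉ (extChartAt I x₀).source) :
    chartExtendMap I x₀ ρ x = x := if_neg hx

lemma chartExtendFun_of_mem (hx : x ∈ (extChartAt I x₀).source) :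
    chartExtendFun I x₀ K x = K (extChartAt I x₀ x) := if_pos hx

lemma chartExtendFun_of_notMem (hx : x ∉ (extChartAt I x₀).source) :
    chartExtendFun I x₀ K x = 0 := if_neg hx

lemma chartExtendMap_mem_source (hρ : MapsTo ρ (extChartAt I x₀).target (extChartAt I x₀).target)
    (hx : x ∈ (extChartAt I x₀).source) : chartExtendMap I x₀ ρ x ∈ (extChartAt I x₀).source := by
  rw [chartExtendMap_of_mem hx]
  exact (extChartAt I x₀).map_target (hρ ((extChartAt I x₀).map_source hx))

lemma extChartAt_chartExtendMap
    (hρ : MapsTo ρ (extChartAt I x₀).target (extChartAt I x₀).target)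
    (hx : x ∈ (extChartAt I x₀).source) :
    extChartAt I x₀ (chartExtendMap I x₀ ρ x) = ρ (extChartAt I x₀ x) := by
  rw [chartExtendMap_of_mem hx,
    (extChartAt I x₀).right_inv (hρ ((extChartAt I x₀).map_source hx))]

lemma chartExtendMap_eq_self (hρA : ∀ x ∈ (extChartAt I x₀).source, x ∉ A →
    ρ (extChartAt I x₀ x) = extChartAt I x₀ x) (hx : x ∉ A) : chartExtendMap I x₀ ρ x = x := by
  by_cases hx' : x ∈ (extChartAt I x₀).source
  · rw [chartExtendMap_of_mem hx', hρA x hx' hx, (extChartAt I x₀).left_inv hx']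
  · exact chartExtendMap_of_notMem hx'

lemma chartExtendMap_comp {ρ₁ ρ₂ : E → E}
    (hρ : MapsTo ρ₂ (extChartAt I x₀).target (extChartAt I x₀).target) (x : M) :
    chartExtendMap I x₀ ρ₁ (chartExtendMap I x₀ ρ₂ x) = chartExtendMap I x₀ (ρ₁ ∘ ρ₂) x := by
  by_cases hx : x ∈ (extChartAt I x₀).source
  · rw [chartExtendMap_of_mem (chartExtendMap_mem_source hρ hx), extChartAt_chartExtendMap hρ hx,
      chartExtendMap_of_mem hx, comp_apply]
  · simp [chartExtendMap_of_notMem hx]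

lemma chartExtendMap_id (x : M) : chartExtendMap I x₀ id x = x := by
  by_cases hx : x ∈ (extChartAt I x₀).source
  · rw [chartExtendMap_of_mem hx, id, (extChartAt I x₀).left_inv hx]
  · exact chartExtendMap_of_notMem hx

/-- A smooth map of the model space, which is the identity away from a closed subset `A` of `M`
contained in the domain of a chart, extends smoothly to `M`. -/
lemma contMDiff_chartExtendMap [IsManifold I ∞ M]
    (hρ : ContDiff ℝ ∞ ρ) (hA : IsClosed A) (hAs : A ⊆ (extChartAt I x₀).source)
    (hρt : MapsTo ρ (extChartAt I x₀).target (extChartAt I x₀).target)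
    (hρA : ∀ x ∈ (extChartAt I x₀).source, x ∉ A → ρ (extChartAt I x₀ x) = extChartAt I x₀ x) :
    ContMDiff I I ∞ (chartExtendMap I x₀ ρ) := by
  intro x
  by_cases hx : x ∈ A
  · have hxs := hAs hx
    have h : ContMDiffOn I I ∞ ((extChartAt I x₀).symm ∘ (ρ ∘ extChartAt I x₀))
        (extChartAt I x₀).source :=
      (contMDiffOn_extChartAt_symm x₀).comp
        (hρ.contMDiff.comp_contMDiffOn (by
          rw [extChartAt_source]
          exact contMDiffOn_extChartAt))
        fun y hy ↦ hρt ((extChartAt I x₀).map_source hy)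
    refine (h.contMDiffAt ((isOpen_extChartAt_source x₀).mem_nhds hxs)).congr_of_eventuallyEq ?_
    filter_upwards [(isOpen_extChartAt_source x₀).mem_nhds hxs] with y hy
    exact chartExtendMap_of_mem hy
  · refine contMDiffAt_id.congr_of_eventuallyEq ?_
    filter_upwards [hA.isOpen_compl.mem_nhds hx] with y hy
    exact chartExtendMap_eq_self hρA hy

/-- A smooth path of functions on the model space, which vanish away from a closed subset `A` of
`M` contained in the domain of a chart, extends smoothly to `M`. -/
lemma contMDiff_chartExtendFun [IsManifold I ∞ M] {K : ℝ → E → ℝ}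
    (hK : ContDiff ℝ ∞ (uncurry K)) (hA : IsClosed A) (hAs : A ⊆ (extChartAt I x₀).source)
    (hKA : ∀ t, ∀ x ∈ (extChartAt I x₀).source, x ∉ A → K t (extChartAt I x₀ x) = 0) :
    ContMDiff (𝓘(ℝ, ℝ).prod I) 𝓘(ℝ, ℝ) ∞
      (uncurry fun (t : ℝ) (x : M) ↦ chartExtendFun I x₀ (K t) x) := by
  rintro ⟨t, x⟩
  by_cases hx : x ∈ A
  · have hmem : {y : ℝ × M | y.2 ∈ (extChartAt I x₀).source} ∈ 𝓝 (t, x) :=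
      ((isOpen_extChartAt_source x₀).preimage continuous_snd).mem_nhds (hAs hx)
    have hΨ : ContMDiffOn (𝓘(ℝ, ℝ).prod I) 𝓘(ℝ, E) ∞ (fun y : ℝ × M ↦ extChartAt I x₀ y.2)
        {y : ℝ × M | y.2 ∈ (extChartAt I x₀).source} := by
      simp only [extChartAt_source]
      exact contMDiffOn_extChartAt.comp contMDiff_snd.contMDiffOn fun y hy ↦ hy
    have h : ContMDiffOn (𝓘(ℝ, ℝ).prod I) 𝓘(ℝ, ℝ) ∞
        (uncurry K ∘ fun y : ℝ × M ↦ (y.1, extChartAt I x₀ y.2))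
        {y : ℝ × M | y.2 ∈ (extChartAt I x₀).source} :=
      hK.contMDiff.comp_contMDiffOn (contMDiff_fst.contMDiffOn.prodMk_space hΨ)
    refine (h.contMDiffAt hmem).congr_of_eventuallyEq ?_
    filter_upwards [hmem] with y hy
    exact chartExtendFun_of_mem hy
  · refine (contMDiffAt_const (c := (0 : ℝ))).congr_of_eventuallyEq ?_
    filter_upwards [(hA.isOpen_compl.preimage continuous_snd).mem_nhds
      (show (t, x) ∈ Prod.snd ⁻¹' Aᶜ from hx)] with y hy
    by_cases hy' : y.2 ∈ (extChartAt I x₀).source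
    · exact (chartExtendFun_of_mem hy').trans (hKA _ _ hy' hy)
    · exact chartExtendFun_of_notMem hy'

lemma hasMFDerivWithinAt_extChartAt_symm_comp [I.Boundaryless] [IsManifold I 1 M] {γ : ℝ → E}
    {t : ℝ} {X : E} (hγ : HasDerivAt γ X t) (ht : γ t ∈ (extChartAt I x₀).target) (s : Set ℝ) :
    HasMFDerivWithinAt 𝓘(ℝ, ℝ) I ((extChartAt I x₀).symm ∘ γ) s t
      ((1 : ℝ →L[ℝ] ℝ).smulRight (mfderiv 𝓘(ℝ, E) I (extChartAt I x₀).symm (γ t) X)) := by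
  have h1 : HasMFDerivAt 𝓘(ℝ, ℝ) 𝓘(ℝ, E) γ t ((1 : ℝ →L[ℝ] ℝ).smulRight X) :=
    hγ.hasFDerivAt.hasMFDerivAt
  have h2 := ((mdifferentiableAt_extChartAt_symm_of_boundaryless ht).hasMFDerivAt.comp t
    h1).hasMFDerivWithinAt (s := s)
  -- stated in `E`, since the tangent spaces which appear are only definitionally equal to `E`
  have hc (L : E →L[ℝ] E) : (1 : ℝ →L[ℝ] ℝ).smulRight (L X) =
      L.comp ((1 : ℝ →L[ℝ] ℝ).smulRight X) :=
    ContinuousLinearMap.ext fun r ↦ (map_smul L r X).symm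
  have h3 := hc (mfderiv 𝓘(ℝ, E) I (extChartAt I x₀).symm (γ t))
  exact Eq.mpr (congrArg (HasMFDerivWithinAt 𝓘(ℝ, ℝ) I ((extChartAt I x₀).symm ∘ γ) s t) h3) h2

lemma hasMFDerivWithinAt_const_smulRight (t : ℝ) (s : Set ℝ) (x : M) :
    HasMFDerivWithinAt 𝓘(ℝ, ℝ) I (fun _ ↦ x) s t
      ((1 : ℝ →L[ℝ] ℝ).smulRight (0 : TangentSpace I x)) := by
  have h3 : (1 : ℝ →L[ℝ] ℝ).smulRight (0 : TangentSpace I x) = 0 :=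
    ContinuousLinearMap.smulRight_zero _
  rw [h3]
  exact hasMFDerivWithinAt_const x s t

end ExtendMap

/-! ### Hamiltonian flows supported in a chart -/

/-- A path of Hamiltonians on `E × E*` together with its flow, all supported in `S × E*`. The
inverse of the flow is recorded since the flow at negative times is not the inverse when the
Hamiltonian depends on time. -/
structure SupportedFlow {E : Type*} [NormedAddCommGroup E] [NormedSpace ℝ E] (S : Set E) where
  /-- the Hamiltonian functions -/
  ham : ℝ → E × (E →L[ℝ] ℝ) → ℝ
  contDiff_ham : ContDiff ℝ ∞ (uncurry ham)
  /-- the flow -/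
  flow : ℝ → E × (E →L[ℝ] ℝ) → E × (E →L[ℝ] ℝ)
  /-- the inverse of the flow at each time -/
  invFlow : ℝ → E × (E →L[ℝ] ℝ) → E × (E →L[ℝ] ℝ)
  contDiff_flow : ∀ t, ContDiff ℝ ∞ (flow t)
  contDiff_invFlow : ∀ t, ContDiff ℝ ∞ (invFlow t)
  flow_zero : ∀ y, flow 0 y = y
  invFlow_flow : ∀ t y, invFlow t (flow t y) = y
  flow_invFlow : ∀ t y, flow t (invFlow t y) = y
  hamilton : ∀ t y, ∃ X, HasDerivAt (fun s ↦ flow s y) X t ∧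
    ∀ w, fderiv ℝ (ham t) (flow t y) w = stdForm X w
  ham_eq_zero : ∀ t, ∀ y : E × (E →L[ℝ] ℝ), y.1 ∉ S → ham t y = 0
  flow_eq_self : ∀ t, ∀ y : E × (E →L[ℝ] ℝ), y.1 ∉ S → flow t y = y

namespace SupportedFlow

variable {E : Type*} [NormedAddCommGroup E] [NormedSpace ℝ E] {S : Set E}

lemma differentiable_ham (F : SupportedFlow S) (t : ℝ) : Differentiable ℝ (F.ham t) :=
  (F.contDiff_ham.comp (contDiff_prodMk_right t)).differentiable (by simp)

lemma invFlow_eq_self (F : SupportedFlow S) (t : ℝ) {y : E × (E →L[ℝ] ℝ)} (hy : y.1 ∉ S) :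
    F.invFlow t y = y := by
  conv_lhs => rw [← F.flow_eq_self t y hy, F.invFlow_flow]

lemma flow_fst_mem (F : SupportedFlow S) (t : ℝ) {y : E × (E →L[ℝ] ℝ)} (hy : y.1 ∈ S) :
    (F.flow t y).1 ∈ S := by
  by_contra h
  have := F.invFlow_eq_self t h
  rw [F.invFlow_flow] at this
  exact h (this ▸ hy)

lemma invFlow_fst_mem (F : SupportedFlow S) (t : ℝ) {y : E × (E →L[ℝ] ℝ)} (hy : y.1 ∈ S) :
    (F.invFlow t y).1 ∈ S := by
  by_contra h
  have := F.flow_eq_self t _ h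
  rw [F.flow_invFlow] at this
  exact h (this ▸ hy)

end SupportedFlow

section Cotangent

variable {n : ℕ} {N : Type*} [TopologicalSpace N] [ChartedSpace (EuclideanSpace ℝ (Fin n)) N]
  [IsManifold (𝓡 n) ∞ N]

/-- Hamilton's equation may be checked in any chart of the cotangent bundle. -/
lemma isSymplecticGradientAt_of_chart {x₀ z : CotangentBundle n N} {K : PhaseSpace n → ℝ}
    {f : CotangentBundle n N → ℝ} (hz : z ∈ (extChartAt (cotangentModel n) x₀).source)
    (hK : DifferentiableAt ℝ K (extChartAt (cotangentModel n) x₀ z))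
    (hf : f =ᶠ[𝓝 z] K ∘ extChartAt (cotangentModel n) x₀) {X : PhaseSpace n}
    (hX : ∀ w, fderiv ℝ K (extChartAt (cotangentModel n) x₀ z) w = stdForm X w)
    {V : TangentSpace (cotangentModel n) z}
    (hV : mfderiv (cotangentModel n) 𝓘(ℝ, PhaseSpace n) (extChartAt (cotangentModel n) x₀) z V
      = X) :
    IsSymplecticGradientAt (canonicalForm n N) f z V := by
  intro w
  rw [canonicalForm_eq_stdForm hz, hV, hf.mfderiv_eq, mfderiv_comp z hK.mdifferentiableAt
    (mdifferentiableAt_extChartAt (by rwa [← extChartAt_source (cotangentModel n)])),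
    mfderiv_eq_fderiv]
  exact hX _

lemma isSymplecticGradientAt_zero {z : CotangentBundle n N} {f : CotangentBundle n N → ℝ}
    (hf : f =ᶠ[𝓝 z] fun _ ↦ 0) : IsSymplecticGradientAt (canonicalForm n N) f z 0 := by
  intro w
  rw [canonicalForm_eq_stdForm_self, hf.mfderiv_eq, mfderiv_const, map_zero]
  have h (w : PhaseSpace n) : (0 : ℝ) = stdForm 0 w := by simp [stdForm]
  exact h _

variable {S : Set (EuclideanSpace ℝ (Fin n))} {x₀ : CotangentBundle n N}

/-- The part of the cotangent bundle lying over the part of the base which has coordinates in `S`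
in the chart around `x₀.proj`. -/
def overChartSet (x₀ : CotangentBundle n N) (S : Set (EuclideanSpace ℝ (Fin n))) :
    Set (CotangentBundle n N) :=
  Bundle.TotalSpace.proj ⁻¹' ((extChartAt (𝓡 n) x₀.proj).symm '' S)

lemma isClosed_overChartSet [T2Space N] (hS : IsCompact S)
    (hSt : S ⊆ (extChartAt (𝓡 n) x₀.proj).target) : IsClosed (overChartSet x₀ S) := by
  have h : IsClosed ((extChartAt (𝓡 n) x₀.proj).symm '' S) :=
    (hS.image_of_continuousOn ((continuousOn_extChartAt_symm _).mono hSt)).isClosed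
  exact h.preimage (FiberBundle.continuous_proj (EuclideanSpace ℝ (Fin n) →L[ℝ] ℝ) _)

lemma overChartSet_subset (hSt : S ⊆ (extChartAt (𝓡 n) x₀.proj).target) :
    overChartSet x₀ S ⊆ (extChartAt (cotangentModel n) x₀).source := by
  rw [extChartAt_cotangent_source]
  rintro x ⟨y, hy, hyx⟩
  rw [mem_preimage, ← hyx]
  exact (extChartAt (𝓡 n) x₀.proj).map_target (hSt hy)

lemma mem_overChartSet {x : CotangentBundle n N}
    (hx : x ∈ (extChartAt (cotangentModel n) x₀).source)
    (hxS : (extChartAt (cotangentModel n) x₀ x).1 ∈ S) : x ∈ overChartSet x₀ S := by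
  rw [extChartAt_cotangent_source] at hx
  refine ⟨_, hxS, ?_⟩
  rw [extChartAt_cotangent_apply_fst]
  exact (extChartAt (𝓡 n) x₀.proj).left_inv hx

namespace SupportedFlow

lemma mapsTo_flow (hSt : S ⊆ (extChartAt (𝓡 n) x₀.proj).target) (F : SupportedFlow S) (t : ℝ) :
    MapsTo (F.flow t) (extChartAt (cotangentModel n) x₀).target
      (extChartAt (cotangentModel n) x₀).target := by
  intro y hy
  by_cases hyS : y.1 ∈ S
  · rw [extChartAt_cotangent_target]
    exact ⟨hSt (F.flow_fst_mem t hyS), mem_univ _⟩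
  · rwa [F.flow_eq_self t y hyS]

lemma mapsTo_invFlow (hSt : S ⊆ (extChartAt (𝓡 n) x₀.proj).target) (F : SupportedFlow S) (t : ℝ) :
    MapsTo (F.invFlow t) (extChartAt (cotangentModel n) x₀).target
      (extChartAt (cotangentModel n) x₀).target := by
  intro y hy
  by_cases hyS : y.1 ∈ S
  · rw [extChartAt_cotangent_target]
    exact ⟨hSt (F.invFlow_fst_mem t hyS), mem_univ _⟩
  · rwa [F.invFlow_eq_self t hyS]

/-- The flow of `F`, extended to the cotangent bundle by the identity. -/
noncomputable def extendFlow [T2Space N] (hS : IsCompact S)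
    (hSt : S ⊆ (extChartAt (𝓡 n) x₀.proj).target) (F : SupportedFlow S) (t : ℝ) :
    CotangentBundle n N ≃ₘ⟮cotangentModel n, cotangentModel n⟯ CotangentBundle n N where
  toFun := chartExtendMap (cotangentModel n) x₀ (F.flow t)
  invFun := chartExtendMap (cotangentModel n) x₀ (F.invFlow t)
  left_inv x := by
    have : F.invFlow t ∘ F.flow t = id := funext (F.invFlow_flow t)
    rw [chartExtendMap_comp (F.mapsTo_flow hSt t), this, chartExtendMap_id]
  right_inv x := by
    have : F.flow t ∘ F.invFlow t = id := funext (F.flow_invFlow t)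
    rw [chartExtendMap_comp (F.mapsTo_invFlow hSt t), this, chartExtendMap_id]
  contMDiff_toFun := contMDiff_chartExtendMap (F.contDiff_flow t) (isClosed_overChartSet hS hSt)
    (overChartSet_subset hSt) (F.mapsTo_flow hSt t)
    fun _ hx hxA ↦ F.flow_eq_self t _ fun h ↦ hxA (mem_overChartSet hx h)
  contMDiff_invFun := contMDiff_chartExtendMap (F.contDiff_invFlow t)
    (isClosed_overChartSet hS hSt) (overChartSet_subset hSt) (F.mapsTo_invFlow hSt t)
    fun _ hx hxA ↦ F.invFlow_eq_self t fun h ↦ hxA (mem_overChartSet hx h)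

/-- Hamilton's equation for the extensions of `F.ham` and `F.flow` to the cotangent bundle. -/
lemma extend_hamilton [T2Space N] (hS : IsCompact S)
    (hSt : S ⊆ (extChartAt (𝓡 n) x₀.proj).target) (F : SupportedFlow S) (t : ℝ)
    (x : CotangentBundle n N) :
    ∃ V : TangentSpace (cotangentModel n) (chartExtendMap (cotangentModel n) x₀ (F.flow t) x),
      IsSymplecticGradientAt (canonicalForm n N) (chartExtendFun (cotangentModel n) x₀ (F.ham t))
        (chartExtendMap (cotangentModel n) x₀ (F.flow t) x) V ∧
      HasMFDerivWithinAt 𝓘(ℝ, ℝ) (cotangentModel n)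
        (fun s ↦ chartExtendMap (cotangentModel n) x₀ (F.flow s) x) (Icc 0 1) t
        ((1 : ℝ →L[ℝ] ℝ).smulRight V) := by
  by_cases hx : x ∈ (extChartAt (cotangentModel n) x₀).source
  · have hyt := F.mapsTo_flow hSt t ((extChartAt (cotangentModel n) x₀).map_source hx)
    have hzs := chartExtendMap_mem_source (F.mapsTo_flow hSt t) hx
    obtain ⟨X, hX, hXham⟩ := F.hamilton t (extChartAt (cotangentModel n) x₀ x)
    have h3 : (fun s ↦ chartExtendMap (cotangentModel n) x₀ (F.flow s) x) =
        (extChartAt (cotangentModel n) x₀).symm ∘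
          fun s ↦ F.flow s (extChartAt (cotangentModel n) x₀ x) :=
      funext fun s ↦ chartExtendMap_of_mem hx
    refine ⟨mfderiv 𝓘(ℝ, PhaseSpace n) (cotangentModel n) (extChartAt (cotangentModel n) x₀).symm
      (F.flow t (extChartAt (cotangentModel n) x₀ x)) X, ?_, ?_⟩
    · refine isSymplecticGradientAt_of_chart (X := X) hzs
        (F.differentiable_ham t _) ?_ ?_ ?_
      · filter_upwards [(isOpen_extChartAt_source x₀).mem_nhds hzs] with y hy
        exact chartExtendFun_of_mem hy
      · rwa [extChartAt_chartExtendMap (F.mapsTo_flow hSt t) hx]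
      · have := mfderiv_extChartAt_comp_mfderivWithin_extChartAt_symm hyt
        rw [(cotangentModel n).range_eq_univ, mfderivWithin_univ,
          ← chartExtendMap_of_mem hx] at this
        exact congr($this X)
    · rw [h3]
      exact hasMFDerivWithinAt_extChartAt_symm_comp hX hyt _
  · have h3 : (fun s ↦ chartExtendMap (cotangentModel n) x₀ (F.flow s) x) = fun _ ↦ x :=
      funext fun s ↦ chartExtendMap_of_notMem hx
    refine ⟨0, isSymplecticGradientAt_zero ?_, ?_⟩
    · rw [chartExtendMap_of_notMem hx]
      filter_upwards [(isClosed_overChartSet hS hSt).isOpen_compl.mem_nhds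
        fun h ↦ hx (overChartSet_subset hSt h)] with y hy
      by_cases hys : y ∈ (extChartAt (cotangentModel n) x₀).source
      · rw [chartExtendFun_of_mem hys]
        exact F.ham_eq_zero t _ fun h ↦ hy (mem_overChartSet hys h)
      · exact chartExtendFun_of_notMem hys
    · rw [h3, chartExtendMap_of_notMem hx]
      exact hasMFDerivWithinAt_const_smulRight t _ x

/-- The Hamiltonian of `F`, extended to the cotangent bundle by zero, as a path of Hamiltonians. -/
noncomputable def toHamiltonianPath [T2Space N] (hS : IsCompact S)
    (hSt : S ⊆ (extChartAt (𝓡 n) x₀.proj).target) (F : SupportedFlow S) :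
    HamiltonianPath (canonicalForm n N) where
  ham t := chartExtendFun (cotangentModel n) x₀ (F.ham t)
  smooth_ham := (contMDiff_chartExtendFun F.contDiff_ham (isClosed_overChartSet hS hSt)
    (overChartSet_subset hSt) fun t _ hx hxA ↦ F.ham_eq_zero t _ fun h ↦
      hxA (mem_overChartSet hx h)).contMDiffOn
  flow := F.extendFlow hS hSt
  flow_zero x := by
    have : F.flow 0 = id := funext F.flow_zero
    change chartExtendMap (cotangentModel n) x₀ (F.flow 0) x = x
    rw [this, chartExtendMap_id]
  hamilton t _ x := F.extend_hamilton hS hSt t x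

end SupportedFlow

end Cotangent

/-! ### Explicit Hamiltonian flows on a model space -/

namespace SupportedFlow

section Translation

variable {E : Type*} [NormedAddCommGroup E] [NormedSpace ℝ E] {S : Set E}

/-- The identity, as the flow of the zero Hamiltonian. -/
def trivial (S : Set E) : SupportedFlow S where
  ham _ _ := 0
  contDiff_ham := contDiff_const
  flow _ y := y
  invFlow _ y := y
  contDiff_flow _ := contDiff_id
  contDiff_invFlow _ := contDiff_id
  flow_zero _ := rfl
  invFlow_flow _ _ := rfl
  flow_invFlow _ _ := rfl
  hamilton t y := ⟨0, hasDerivAt_const t y, fun w ↦ by simp [stdForm]⟩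
  ham_eq_zero _ _ _ := rfl
  flow_eq_self _ _ _ := rfl

lemma fderiv_eq_zero_of_notMem (hS : IsClosed S) {f : E → ℝ} (hfS : ∀ q ∉ S, f q = 0) {q : E}
    (hq : q ∉ S) : fderiv ℝ f q = 0 := by
  have h : f =ᶠ[𝓝 q] fun _ ↦ 0 := by
    filter_upwards [hS.isOpen_compl.mem_nhds hq] with q hq using hfS q hq
  simp [h.fderiv_eq]

/-- The composition of the flow of `G` with the fibrewise translations
`(q, p) ↦ (q, p + t df(q))`, which form the flow of the function `(q, p) ↦ f q`. -/
noncomputable def translate (hS : IsClosed S) (f : E → ℝ) (hf : ContDiff ℝ ∞ f)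
    (hfS : ∀ q ∉ S, f q = 0) (G : SupportedFlow S) : SupportedFlow S where
  ham t y := f y.1 + G.ham t (y.1, y.2 - t • fderiv ℝ f y.1)
  contDiff_ham := by
    have h : ContDiff ℝ ∞ (fderiv ℝ f) := hf.fderiv_right (by simp)
    have h1 : ContDiff ℝ ∞ (fun z : ℝ × (E × (E →L[ℝ] ℝ)) ↦ z.2.1) := contDiff_snd.fst
    have h2 : ContDiff ℝ ∞ (fun z : ℝ × (E × (E →L[ℝ] ℝ)) ↦
        (z.1, (z.2.1, z.2.2 - z.1 • fderiv ℝ f z.2.1))) :=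
      contDiff_fst.prodMk (h1.prodMk (contDiff_snd.snd.sub (contDiff_fst.smul (h.comp h1))))
    exact (hf.comp h1).add (G.contDiff_ham.comp h2)
  flow t y := ((G.flow t y).1, (G.flow t y).2 + t • fderiv ℝ f (G.flow t y).1)
  invFlow t y := G.invFlow t (y.1, y.2 - t • fderiv ℝ f y.1)
  contDiff_flow t := by
    have h : ContDiff ℝ ∞ (fderiv ℝ f) := hf.fderiv_right (by simp)
    have hG := G.contDiff_flow t
    exact hG.fst.prodMk (hG.snd.add ((h.comp hG.fst).const_smul t))
  contDiff_invFlow t := by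
    have h : ContDiff ℝ ∞ (fderiv ℝ f) := hf.fderiv_right (by simp)
    exact (G.contDiff_invFlow t).comp
      (contDiff_fst.prodMk (contDiff_snd.sub ((h.comp contDiff_fst).const_smul t)))
  flow_zero y := by simp [G.flow_zero]
  invFlow_flow t y := by simp [G.invFlow_flow]
  flow_invFlow t y := by simp [G.flow_invFlow]
  hamilton t y := by
    obtain ⟨Y, hY, hYham⟩ := G.hamilton t y
    set z := G.flow t y with hz
    have hf2 : ContDiff ℝ ∞ (fderiv ℝ f) := hf.fderiv_right (by simp)
    have hD : HasFDerivAt (fderiv ℝ f) (fderiv ℝ (fderiv ℝ f) z.1) z.1 :=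
      (hf2.differentiable (by simp) z.1).hasFDerivAt
    have hd : HasFDerivAt f (fderiv ℝ f z.1) z.1 := (hf.differentiable (by simp) z.1).hasFDerivAt
    have hsymm : ∀ v w, fderiv ℝ (fderiv ℝ f) z.1 v w = fderiv ℝ (fderiv ℝ f) z.1 w v :=
      ((contDiff_infty.1 hf 2).contDiffAt.isSymmSndFDerivAt (by simp)).eq
    have hY1 : HasDerivAt (fun s ↦ (G.flow s y).1) Y.1 t := hY.fst
    have hY2 : HasDerivAt (fun s ↦ (G.flow s y).2) Y.2 t := hY.snd
    have hDs : HasDerivAt (fun s ↦ fderiv ℝ f (G.flow s y).1)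
        (fderiv ℝ (fderiv ℝ f) z.1 Y.1) t := hD.comp_hasDerivAt t hY1
    refine ⟨_, hY1.prodMk (hY2.add ((hasDerivAt_id t).smul hDs)), fun w ↦ ?_⟩
    set u : E × (E →L[ℝ] ℝ) := (z.1, z.2 + t • fderiv ℝ f z.1) with hu
    have hfst : HasFDerivAt (Prod.fst : E × (E →L[ℝ] ℝ) → E)
        (ContinuousLinearMap.fst ℝ _ _) u := hasFDerivAt_fst
    have hfu : HasFDerivAt (fun y : E × (E →L[ℝ] ℝ) ↦ f y.1) _ u := hd.comp u hfst
    have hDu : HasFDerivAt (fun y : E × (E →L[ℝ] ℝ) ↦ fderiv ℝ f y.1) _ u := hD.comp u hfst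
    have hT : HasFDerivAt (fun y : E × (E →L[ℝ] ℝ) ↦ (y.1, y.2 - t • fderiv ℝ f y.1)) _ u :=
      hfst.prodMk (hasFDerivAt_snd.sub (hDu.const_smul t))
    have hTu : (u.1, u.2 - t • fderiv ℝ f u.1) = z := by simp [hu]
    have hGz : HasFDerivAt (G.ham t) (fderiv ℝ (G.ham t) z) (u.1, u.2 - t • fderiv ℝ f u.1) := by
      rw [hTu]
      exact (G.differentiable_ham t z).hasFDerivAt
    have hall := hfu.add (hGz.comp u hT)
    rw [show fderiv ℝ (fun y : E × (E →L[ℝ] ℝ) ↦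
      f y.1 + G.ham t (y.1, y.2 - t • fderiv ℝ f y.1)) u = _ from hall.fderiv]
    simp [hYham, stdForm, hsymm Y.1]
    ring
  ham_eq_zero t y hy := by
    rw [hfS _ hy, G.ham_eq_zero t _ (by exact hy), add_zero]
  flow_eq_self t y hy := by
    simp [G.flow_eq_self t y hy, fderiv_eq_zero_of_notMem hS hfS hy]

lemma translate_flow (hS : IsClosed S) {f : E → ℝ} (hf : ContDiff ℝ ∞ f)
    (hfS : ∀ q ∉ S, f q = 0) (G : SupportedFlow S) (t : ℝ) (y : E × (E →L[ℝ] ℝ)) :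
    (translate hS f hf hfS G).flow t y =
      ((G.flow t y).1, (G.flow t y).2 + t • fderiv ℝ f (G.flow t y).1) := rfl

end Translation

section Rotation

variable {E : Type*} [NormedAddCommGroup E] [InnerProductSpace ℝ E] [CompleteSpace E]

/-- The vector `p♯` which represents the covector `p`. -/
noncomputable def sharp : (E →L[ℝ] ℝ) →L[ℝ] E where
  toFun := (InnerProductSpace.toDual ℝ E).symm
  map_add' := map_add _
  map_smul' c p := by simp
  cont := (InnerProductSpace.toDual ℝ E).symm.continuous

@[simp]
lemma sharp_innerSL (q : E) : sharp (innerSL ℝ q) = q :=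
  (InnerProductSpace.toDual ℝ E).symm_apply_apply q

@[simp]
lemma innerSL_sharp (p : E →L[ℝ] ℝ) : innerSL ℝ (sharp p) = p :=
  (InnerProductSpace.toDual ℝ E).apply_symm_apply p

@[simp]
lemma norm_sharp (p : E →L[ℝ] ℝ) : ‖sharp p‖ = ‖p‖ :=
  (InnerProductSpace.toDual ℝ E).symm.norm_map p

lemma apply_eq_inner_sharp (p : E →L[ℝ] ℝ) (w : E) : p w = inner ℝ (sharp p) w := by
  conv_lhs => rw [← innerSL_sharp p]
  rfl

/-- The squared radius `|q|² + |p|²`. -/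
noncomputable def sqRadius (z : E × (E →L[ℝ] ℝ)) : ℝ := ‖z.1‖ ^ 2 + ‖sharp z.2‖ ^ 2

/-- Multiplication of `q + i p` by `exp (i θ)`. -/
noncomputable def rotate (θ : ℝ) (z : E × (E →L[ℝ] ℝ)) : E × (E →L[ℝ] ℝ) :=
  (Real.cos θ • z.1 - Real.sin θ • sharp z.2, Real.cos θ • z.2 + Real.sin θ • innerSL ℝ z.1)

lemma sqRadius_rotate (θ : ℝ) (z : E × (E →L[ℝ] ℝ)) : sqRadius (rotate θ z) = sqRadius z := by
  simp only [sqRadius, rotate, map_add, map_smul, sharp_innerSL]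
  rw [norm_sub_sq_real, norm_add_sq_real]
  simp only [norm_smul, inner_smul_left, inner_smul_right, mul_pow, Real.norm_eq_abs, sq_abs,
    RCLike.conj_to_real, real_inner_comm z.1]
  linear_combination (‖z.1‖ ^ 2 + ‖sharp z.2‖ ^ 2) * Real.sin_sq_add_cos_sq θ

lemma rotate_zero (z : E × (E →L[ℝ] ℝ)) : rotate 0 z = z := by simp [rotate]

lemma rotate_pi (z : E × (E →L[ℝ] ℝ)) : rotate Real.pi z = -z := by
  simp [rotate, Prod.ext_iff, neg_one_smul ℝ z.2]

lemma rotate_neg_rotate (θ : ℝ) (z : E × (E →L[ℝ] ℝ)) : rotate (-θ) (rotate θ z) = z := by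
  have h := Real.sin_sq_add_cos_sq θ
  simp only [rotate, map_add, map_sub, map_smul, sharp_innerSL, innerSL_sharp, Real.cos_neg,
    Real.sin_neg]
  refine Prod.ext ?_ ?_
  · match_scalars
    · linear_combination h
    · ring
  · match_scalars
    · linear_combination h
    · ring

lemma contDiff_sqRadius : ContDiff ℝ ∞ (sqRadius : E × (E →L[ℝ] ℝ) → ℝ) :=
  (contDiff_fst.norm_sq ℝ).add ((sharp.contDiff.comp contDiff_snd).norm_sq ℝ)

lemma fderiv_sqRadius_apply (z w : E × (E →L[ℝ] ℝ)) :
    fderiv ℝ sqRadius z w = 2 * (inner ℝ z.1 w.1 + w.2 (sharp z.2)) := by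
  have h1 : HasFDerivAt (fun z : E × (E →L[ℝ] ℝ) ↦ ‖z.1‖ ^ 2) _ z := hasFDerivAt_fst.norm_sq
  have h2 : HasFDerivAt (fun z : E × (E →L[ℝ] ℝ) ↦ ‖sharp z.2‖ ^ 2) _ z :=
    (sharp.hasFDerivAt.comp z hasFDerivAt_snd).norm_sq
  have h3 : HasFDerivAt sqRadius _ z := h1.add h2
  rw [h3.fderiv, apply_eq_inner_sharp w.2, real_inner_comm (sharp z.2)]
  simp [apply_eq_inner_sharp z.2]
  ring

lemma hasDerivAt_rotate (a t : ℝ) (z : E × (E →L[ℝ] ℝ)) :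
    HasDerivAt (fun s ↦ rotate (s * a) z)
      (a • (-sharp (rotate (t * a) z).2, innerSL ℝ (rotate (t * a) z).1)) t := by
  have hs : HasDerivAt (fun s ↦ s * a) a t := by simpa using (hasDerivAt_id t).mul_const a
  have hc := hs.cos
  have hsn := hs.sin
  have key := ((hc.smul_const z.1).sub (hsn.smul_const (sharp z.2))).prodMk
    ((hc.smul_const z.2).add (hsn.smul_const (innerSL ℝ z.1)))
  refine key.congr_deriv ?_
  simp only [rotate, map_add, map_sub, map_smul, sharp_innerSL, innerSL_sharp, Prod.smul_mk]
  refine Prod.ext ?_ ?_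
  · dsimp only
    module
  · dsimp only
    module

lemma contDiff_rotation {h : ℝ → ℝ} (hh : ContDiff ℝ ∞ h) (o : E × (E →L[ℝ] ℝ)) (t : ℝ) :
    ContDiff ℝ ∞ fun y ↦ o + rotate (t * (2 * deriv h (sqRadius (y - o)))) (y - o) := by
  have h1 : ContDiff ℝ ∞ (fun y : E × (E →L[ℝ] ℝ) ↦ y - o) := contDiff_id.sub contDiff_const
  have h2 : ContDiff ℝ ∞ (deriv h) := (contDiff_infty_iff_deriv.1 hh).2
  have h3 : ContDiff ℝ ∞ (fun y ↦ t * (2 * deriv h (sqRadius (y - o)))) :=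
    contDiff_const.mul (contDiff_const.mul (h2.comp (contDiff_sqRadius.comp h1)))
  have h4 := Real.contDiff_cos.comp h3
  have h5 := Real.contDiff_sin.comp h3
  refine contDiff_const.add (ContDiff.prodMk ?_ ?_)
  · exact (h4.smul h1.fst).sub (h5.smul (sharp.contDiff.comp h1.snd))
  · exact (h4.smul h1.snd).add (h5.smul ((innerSL ℝ).contDiff.comp h1.fst))

variable {S : Set E}

/-- The flow of the Hamiltonian `z ↦ h (|z - o|²)`: the point `z` rotates around `o` with the
angular velocity `2 h' (|z - o|²)`. -/
noncomputable def rotation (h : ℝ → ℝ) (hh : ContDiff ℝ ∞ h) (o : E × (E →L[ℝ] ℝ)) {r : ℝ}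
    (hr : ∀ s, r ^ 2 ≤ s → h s = 0) (hr0 : 0 ≤ r) (hS : Metric.closedBall o.1 r ⊆ S) :
    SupportedFlow S where
  ham _ y := h (sqRadius (y - o))
  contDiff_ham := hh.comp (contDiff_sqRadius.comp (contDiff_snd.sub contDiff_const))
  flow t y := o + rotate (t * (2 * deriv h (sqRadius (y - o)))) (y - o)
  invFlow t y := o + rotate (-t * (2 * deriv h (sqRadius (y - o)))) (y - o)
  contDiff_flow t := contDiff_rotation hh o t
  contDiff_invFlow t := contDiff_rotation hh o (-t)
  flow_zero y := by simp [rotate_zero]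
  invFlow_flow t y := by
    rw [add_sub_cancel_left, sqRadius_rotate, neg_mul, rotate_neg_rotate, add_sub_cancel]
  flow_invFlow t y := by
    rw [add_sub_cancel_left, sqRadius_rotate, ← neg_neg t, neg_mul (-t), neg_neg t,
      rotate_neg_rotate, add_sub_cancel]
  hamilton t y := by
    refine ⟨_, (hasDerivAt_rotate _ t _).const_add o, fun w ↦ ?_⟩
    have h1 : HasFDerivAt (fun y ↦ h (sqRadius (y - o)))
        (deriv h (sqRadius (y - o)) • fderiv ℝ sqRadius
          (rotate (t * (2 * deriv h (sqRadius (y - o)))) (y - o)))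
        (o + rotate (t * (2 * deriv h (sqRadius (y - o)))) (y - o)) := by
      have h2 : HasDerivAt h (deriv h (sqRadius (y - o)))
          (sqRadius (o + rotate (t * (2 * deriv h (sqRadius (y - o)))) (y - o) - o)) := by
        rw [add_sub_cancel_left, sqRadius_rotate]
        exact (hh.differentiable (by simp) _).hasDerivAt
      have h3 : HasFDerivAt (fun y ↦ sqRadius (y - o)) (fderiv ℝ sqRadius
          (rotate (t * (2 * deriv h (sqRadius (y - o)))) (y - o)))
          (o + rotate (t * (2 * deriv h (sqRadius (y - o)))) (y - o)) := by
        rw [hasFDerivAt_comp_sub, add_sub_cancel_left]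
        exact (contDiff_sqRadius.differentiable (by simp) _).hasFDerivAt
      exact HasDerivAt.comp_hasFDerivAt (h₂ := h) _ h2 h3
    rw [h1.fderiv]
    simp only [smul_apply, fderiv_sqRadius_apply, stdForm, Prod.smul_mk,
      smul_eq_mul, innerSL_apply_apply, map_smul, map_neg]
    ring
  ham_eq_zero _ y hy := by
    refine hr _ ?_
    have h1 : r < ‖y.1 - o.1‖ := by
      by_contra hle
      exact hy (hS (by simpa [dist_eq_norm] using hle))
    have h2 : r ^ 2 ≤ ‖y.1 - o.1‖ ^ 2 := by gcongr
    exact h2.trans (le_add_of_nonneg_right (by positivity))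
  flow_eq_self t y hy := by
    have h1 : r < ‖y.1 - o.1‖ := by
      by_contra hle
      exact hy (hS (by simpa [dist_eq_norm] using hle))
    have h2 : r ^ 2 < ‖y.1 - o.1‖ ^ 2 := by gcongr
    have h3 : r ^ 2 < sqRadius (y - o) :=
      h2.trans_le (le_add_of_nonneg_right (by positivity))
    have h4 : h =ᶠ[𝓝 (sqRadius (y - o))] fun _ ↦ 0 := by
      filter_upwards [Ioi_mem_nhds h3] with s hs using hr s (le_of_lt hs)
    simp [h4.deriv_eq, rotate_zero]

lemma rotation_flow {h : ℝ → ℝ} (hh : ContDiff ℝ ∞ h) (o : E × (E →L[ℝ] ℝ)) {r : ℝ}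
    (hr : ∀ s, r ^ 2 ≤ s → h s = 0) (hr0 : 0 ≤ r) (hrS : Metric.closedBall o.1 r ⊆ S) (t : ℝ)
    (y : E × (E →L[ℝ] ℝ)) : (rotation h hh o hr hr0 hrS).flow t y =
      o + rotate (t * (2 * deriv h (sqRadius (y - o)))) (y - o) := rfl

end Rotation

end SupportedFlow

/-- A function vanishing on `[r², ∞)` for which some rotation angle `2 h'(s)` is exactly `π`. -/
lemma exists_profile {r : ℝ} (hr : 0 < r) : ∃ h : ℝ → ℝ, ContDiff ℝ ∞ h ∧
    (∀ s, r ^ 2 ≤ s → h s = 0) ∧ ∃ s, 0 < s ∧ s < r ^ 2 ∧ 2 * deriv h s = Real.pi := by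
  have hr2 : 0 < r ^ 2 := by positivity
  let g : ContDiffBump (0 : ℝ) := ⟨r ^ 2 / 2, r ^ 2, by positivity, by linarith⟩
  have hg : ContDiff ℝ ∞ g := g.contDiff
  have hg0 : g 0 = 1 := g.one_of_mem_closedBall (by simp [g]; positivity)
  have hgr : ∀ s, r ^ 2 ≤ s → g s = 0 := fun s hs ↦ g.zero_of_le_dist (by
    simpa [g] using hs.trans (le_abs_self s))
  obtain ⟨s, hs, hsd⟩ := exists_deriv_eq_slope g hr2 hg.continuous.continuousOn
    (hg.differentiable (by simp)).differentiableOn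
  rw [hg0, hgr _ le_rfl] at hsd
  have hne : deriv g s ≠ 0 := by
    rw [hsd]
    exact div_ne_zero (by norm_num) (by linarith)
  -- rescale a bump function, so that the angle at a point where its derivative is nonzero is `π`
  refine ⟨fun s' ↦ Real.pi / (2 * deriv g s) * g s', contDiff_const.mul hg,
    fun s' hs' ↦ by simp [hgr s' hs'], s, hs.1, hs.2, ?_⟩
  rw [deriv_const_mul _ (hg.differentiable (by simp) s)]
  field_simp

/-! ### Bi-invariant metrics -/

/-- Conjugate elements `φ` and `φ' = χ φ χ⁻¹` have the same distance to the identity `e`. The only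
product which has to be known to lie in `G` is `ψ = χ φ = φ' χ`. -/
lemma IsBiinvariantMetric.dist_eq_of_conj {E H M : Type*} [NormedAddCommGroup E] [NormedSpace ℝ E]
    [TopologicalSpace H] {I : ModelWithCorners ℝ E H} [TopologicalSpace M] [ChartedSpace H M]
    {G : Set (M ≃ₘ⟮I, I⟯ M)} {d : G → G → ℝ} (hd : IsBiinvariantMetric G d)
    {e φ φ' χ ψ : G} (he : ∀ x, e.1 x = x) (h : ∀ x, ψ.1 x = χ.1 (φ.1 x))
    (h' : ∀ x, ψ.1 x = φ'.1 (χ.1 x)) : d e φ = d e φ' :=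
  (hd.left_invariant e φ χ χ ψ (fun x ↦ by rw [he]) h).trans
    (hd.right_invariant e φ' χ χ ψ (fun x ↦ by rw [he]) h').symm

lemma IsCMinusOne.tendsto_dist {E H M : Type*} [NormedAddCommGroup E] [NormedSpace ℝ E]
    [TopologicalSpace H] {I : ModelWithCorners ℝ E H} [TopologicalSpace M] [ChartedSpace H M]
    {Ω : ∀ x : M, TangentSpace I x → TangentSpace I x → ℝ}
    {d : hamiltonianDiffeos Ω → hamiltonianDiffeos Ω → ℝ}
    (hd : IsCMinusOne Ω (hamiltonianDiffeos Ω) d) (g : HamiltonianPath Ω)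
    {h : ℕ → HamiltonianPath Ω} {h₀ : HamiltonianPath Ω}
    (hh : Filter.Tendsto h Filter.atTop (𝓝 h₀)) :
    Filter.Tendsto (fun k ↦ d ⟨g.timeOne, g, rfl⟩ ⟨(h k).timeOne, h k, rfl⟩) Filter.atTop
      (𝓝 (d ⟨g.timeOne, g, rfl⟩ ⟨h₀.timeOne, h₀, rfl⟩)) := by
  let ι (h : HamiltonianPath Ω) : {h : HamiltonianPath Ω // h.timeOne ∈ hamiltonianDiffeos Ω} :=
    ⟨h, h, rfl⟩
  have hι : Continuous ι := continuous_id.subtype_mk _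
  have hd' := hd.tendsto (ι g, ι h₀)
  exact hd'.comp (tendsto_const_nhds.prodMk_nhds ((hι.tendsto _).comp hh))

section Cotangent

variable {n : ℕ} {N : Type*} [TopologicalSpace N] [ChartedSpace (EuclideanSpace ℝ (Fin n)) N]
  [IsManifold (𝓡 n) ∞ N] {S : Set (EuclideanSpace ℝ (Fin n))} {x₀ : CotangentBundle n N}

lemma SupportedFlow.timeOne_apply [T2Space N] (hS : IsCompact S)
    (hSt : S ⊆ (extChartAt (𝓡 n) x₀.proj).target) (F : SupportedFlow S) (x : CotangentBundle n N) :
    (F.toHamiltonianPath hS hSt).timeOne x =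
      chartExtendMap (cotangentModel n) x₀ (F.flow 1) x := rfl

lemma SupportedFlow.flow_eq_self_of_timeOne [T2Space N] (hS : IsCompact S)
    (hSt : S ⊆ (extChartAt (𝓡 n) x₀.proj).target) (F : SupportedFlow S)
    (hF : ∀ x, (F.toHamiltonianPath hS hSt).timeOne x = x) (z : PhaseSpace n) (hz : z.1 ∈ S) :
    F.flow 1 z = z := by
  have hzt : z ∈ (extChartAt (cotangentModel n) x₀).target := by
    rw [extChartAt_cotangent_target]
    exact ⟨hSt hz, mem_univ _⟩
  have h := extChartAt_chartExtendMap (F.mapsTo_flow hSt 1)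
    ((extChartAt (cotangentModel n) x₀).map_target hzt)
  rwa [← F.timeOne_apply hS hSt, hF, (extChartAt (cotangentModel n) x₀).right_inv hzt,
    eq_comm] at h

lemma SupportedFlow.timeOne_comp [T2Space N] (hS : IsCompact S)
    (hSt : S ⊆ (extChartAt (𝓡 n) x₀.proj).target) {F₁ F₂ F : SupportedFlow S}
    (h : ∀ y, F.flow 1 y = F₁.flow 1 (F₂.flow 1 y)) (x : CotangentBundle n N) :
    (F.toHamiltonianPath hS hSt).timeOne x =
      (F₁.toHamiltonianPath hS hSt).timeOne ((F₂.toHamiltonianPath hS hSt).timeOne x) := by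
  simp only [timeOne_apply]
  rw [chartExtendMap_comp (F₂.mapsTo_flow hSt 1)]
  exact congrArg (fun ρ ↦ chartExtendMap (cotangentModel n) x₀ ρ x) (funext h)

/-- Hamiltonians supported over `S × E*` converge to zero in the compact-open topology if they
vanish eventually where the momentum is bounded. -/
lemma tendsto_toHamiltonianPath [T2Space N] (hS : IsCompact S)
    (hSt : S ⊆ (extChartAt (𝓡 n) x₀.proj).target) (F : ℕ → SupportedFlow S)
    (hF : ∀ C : ℝ, ∀ᶠ k in Filter.atTop, ∀ t, ∀ y : PhaseSpace n, ‖y.2‖ ≤ C → (F k).ham t y = 0) :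
    Filter.Tendsto (fun k ↦ (F k).toHamiltonianPath hS hSt) Filter.atTop
      (𝓝 ((SupportedFlow.trivial S).toHamiltonianPath hS hSt)) := by
  rw [nhds_induced, Filter.tendsto_comap_iff,
    ContinuousMap.tendsto_iff_forall_isCompact_tendstoUniformlyOn]
  intro L hL
  have hP : IsCompact (Prod.snd '' L ∩ overChartSet x₀ S) :=
    (hL.image continuous_snd).inter_right (isClosed_overChartSet hS hSt)
  have hcont : ContinuousOn (fun x ↦ (extChartAt (cotangentModel n) x₀ x).2)
      (Prod.snd '' L ∩ overChartSet x₀ S) :=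
    continuous_snd.comp_continuousOn ((continuousOn_extChartAt x₀).mono
      (inter_subset_right.trans (overChartSet_subset hSt)))
  obtain ⟨C, hC⟩ := (hP.image_of_continuousOn hcont).isBounded.exists_norm_le
  rw [Metric.tendstoUniformlyOn_iff]
  intro ε hε
  filter_upwards [hF C] with k hk p hp
  have h1 (y : CotangentBundle n N) :
      chartExtendFun (cotangentModel n) x₀ ((SupportedFlow.trivial S).ham p.1) y = 0 := by
    by_cases hy : y ∈ (extChartAt (cotangentModel n) x₀).source
    · rw [chartExtendFun_of_mem hy]
      rfl
    · exact chartExtendFun_of_notMem hy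
  have h2 : chartExtendFun (cotangentModel n) x₀ ((F k).ham p.1) p.2 = 0 := by
    by_cases hy : p.2 ∈ (extChartAt (cotangentModel n) x₀).source
    · rw [chartExtendFun_of_mem hy]
      by_cases hyS : (extChartAt (cotangentModel n) x₀ p.2).1 ∈ S
      · exact hk _ _ (hC _ (mem_image_of_mem _ ⟨mem_image_of_mem _ hp, mem_overChartSet hy hyS⟩))
      · exact (F k).ham_eq_zero _ _ hyS
    · exact chartExtendFun_of_notMem hy
  change dist (chartExtendFun (cotangentModel n) x₀ ((SupportedFlow.trivial S).ham p.1) p.2)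
    (chartExtendFun (cotangentModel n) x₀ ((F k).ham p.1) p.2) < ε
  rw [h1, h2, dist_self]
  exact hε

end Cotangent

namespace SupportedFlow

variable {E : Type*} [NormedAddCommGroup E] [InnerProductSpace ℝ E] [CompleteSpace E]

/-- If `df = c` on the ball of radius `r` around `q₀`, the translation by `df` conjugates the
rotation around `(q₀, 0)` to the rotation around `(q₀, c)`. -/
lemma translate_rotation {S : Set E} (hS : IsClosed S) {f : E → ℝ} (hf : ContDiff ℝ ∞ f)
    (hfS : ∀ q ∉ S, f q = 0) {h : ℝ → ℝ} (hh : ContDiff ℝ ∞ h) {q₀ : E} {c : E →L[ℝ] ℝ} {r : ℝ}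
    (hr : ∀ s, r ^ 2 ≤ s → h s = 0) (hr0 : 0 ≤ r) (hrS : Metric.closedBall q₀ r ⊆ S)
    (hfc : ∀ q ∈ Metric.closedBall q₀ r, fderiv ℝ f q = c) (y : E × (E →L[ℝ] ℝ)) :
    (translate hS f hf hfS (rotation h hh (q₀, 0) hr hr0 hrS)).flow 1 y =
      (rotation h hh (q₀, c) hr hr0 hrS).flow 1
        ((translate hS f hf hfS (trivial S)).flow 1 y) := by
  have htriv : (trivial S).flow 1 y = y := rfl
  -- the same rotation, seen as supported over the smaller ball
  have hR (c : E →L[ℝ] ℝ) (y : E × (E →L[ℝ] ℝ)) : (rotation h hh (q₀, c) hr hr0 hrS).flow 1 y =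
    (rotation h hh (q₀, c) hr hr0 (Subset.refl (Metric.closedBall q₀ r))).flow 1 y := rfl
  rw [translate_flow, translate_flow, htriv]
  by_cases hy : y.1 ∈ Metric.closedBall q₀ r
  · have hy' : ((rotation h hh (q₀, 0) hr hr0 hrS).flow 1 y).1 ∈ Metric.closedBall q₀ r := by
      rw [hR]
      exact flow_fst_mem _ 1 hy
    have h1 : (y.1, y.2 + (1 : ℝ) • c) - (q₀, c) = y - (q₀, 0) := by
      ext1 <;> simp
    rw [hfc _ hy', hfc _ hy, rotation_flow, rotation_flow, h1]
    generalize rotate _ (y - (q₀, 0)) = w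
    ext1 <;> simp [add_comm]
  · rw [hR, hR, flow_eq_self _ 1 y hy, flow_eq_self _ 1 (y.1, y.2 + (1 : ℝ) • fderiv ℝ f y.1) hy]

lemma rotation_flow_one_eq {S : Set E} {h : ℝ → ℝ} (hh : ContDiff ℝ ∞ h) {q₀ : E} {r : ℝ}
    (hr : ∀ s, r ^ 2 ≤ s → h s = 0) (hr0 : 0 ≤ r) (hrS : Metric.closedBall q₀ r ⊆ S) (v : E)
    (hv : 2 * deriv h (‖v‖ ^ 2) = Real.pi) :
    (rotation h hh (q₀, 0) hr hr0 hrS).flow 1 (q₀ + v, 0) = (q₀ - v, 0) := by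
  have h1 : (q₀ + v, (0 : E →L[ℝ] ℝ)) - (q₀, 0) = (v, 0) := by ext1 <;> simp
  have h2 : sqRadius (v, (0 : E →L[ℝ] ℝ)) = ‖v‖ ^ 2 := by simp [sqRadius]
  rw [rotation_flow, h1, h2, hv, one_mul, rotate_pi]
  ext1 <;> simp [sub_eq_add_neg]

/-- The Hamiltonian of a rotation around a point with large momentum vanishes where the momentum
is small. -/
lemma rotation_ham_eq_zero {S : Set E} {h : ℝ → ℝ} (hh : ContDiff ℝ ∞ h) {q₀ : E}
    {c : E →L[ℝ] ℝ} {r C : ℝ} (hr : ∀ s, r ^ 2 ≤ s → h s = 0) (hr0 : 0 ≤ r)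
    (hrS : Metric.closedBall q₀ r ⊆ S) (hc : C + r ≤ ‖c‖) (t : ℝ) {y : E × (E →L[ℝ] ℝ)}
    (hy : ‖y.2‖ ≤ C) : (rotation h hh (q₀, c) hr hr0 hrS).ham t y = 0 := by
  refine hr _ ?_
  have h1 : r ≤ ‖y.2 - c‖ := by
    have := norm_sub_norm_le c y.2
    rw [norm_sub_rev] at this
    linarith
  have h2 : r ^ 2 ≤ ‖y.2 - c‖ ^ 2 := by gcongr
  simp only [sqRadius, norm_sharp]
  exact h2.trans (le_add_of_nonneg_left (by positivity))

end SupportedFlow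

/-- A linear function, cut off away from a ball. It remains linear on the larger ball of radius
`2 r`, so that its differential is `c` also on the boundary of the ball of radius `r`. -/
lemma exists_eq_linear_near_ball {E : Type*} [NormedAddCommGroup E] [NormedSpace ℝ E]
    [HasContDiffBump E] {r δ : ℝ} (hr : 0 < r) (hrδ : 2 * r < δ) (q₀ : E) (c : E →L[ℝ] ℝ) :
    ∃ f : E → ℝ, ContDiff ℝ ∞ f ∧ (∀ q ∉ Metric.closedBall q₀ δ, f q = 0) ∧
      ∀ q ∈ Metric.closedBall q₀ r, fderiv ℝ f q = c := by
  let β : ContDiffBump q₀ := ⟨2 * r, δ, by positivity, hrδ⟩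
  refine ⟨fun q ↦ β q * c q, β.contDiff.mul c.contDiff, fun q hq ↦ ?_, fun q hq ↦ ?_⟩
  · have : β q = 0 := β.zero_of_le_dist (le_of_lt (by simpa using hq))
    simp [this]
  · have hq' : q ∈ Metric.ball q₀ (2 * r) := Metric.closedBall_subset_ball (by linarith) hq
    have hev : (fun q ↦ β q * c q) =ᶠ[𝓝 q] c := by
      filter_upwards [Metric.isOpen_ball.mem_nhds hq'] with q' hq'
      have : β q' = 1 := β.one_of_mem_closedBall (Metric.ball_subset_closedBall hq')
      simp [this]
    rw [hev.fderiv_eq, ContinuousLinearMap.fderiv]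

end HamiltonianGeometry

open HamiltonianGeometry SupportedFlow in
theorem corollary6 (n : ℕ) (hn : 2 ≤ n)
    (N : Type*) [TopologicalSpace N] [T2Space N] [SecondCountableTopology N] [Nonempty N]
    [ChartedSpace (EuclideanSpace ℝ (Fin n)) N] [IsManifold (𝓡 n) ∞ N] :
    ¬ ∃ d : HamiltonianGeometry.cotangentHamiltonianDiffeos n N →
          HamiltonianGeometry.cotangentHamiltonianDiffeos n N → ℝ,
      HamiltonianGeometry.IsBiinvariantMetric
          (HamiltonianGeometry.cotangentHamiltonianDiffeos n N) d ∧
        HamiltonianGeometry.IsCMinusOne (HamiltonianGeometry.canonicalForm n N)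
          (HamiltonianGeometry.cotangentHamiltonianDiffeos n N) d := by
  rintro ⟨d, hd, hcont⟩
  obtain ⟨b⟩ := ‹Nonempty N›
  let x₀ : CotangentBundle n N := ⟨b, 0⟩
  obtain ⟨q₀, hnhds⟩ : ∃ q₀, (extChartAt (𝓡 n) x₀.proj).target ∈ 𝓝 q₀ :=
    ⟨_, extChartAt_target_mem_nhds (I := 𝓡 n) b⟩
  obtain ⟨δ, hδ, hδt⟩ := Metric.nhds_basis_closedBall.mem_iff.1 hnhds
  obtain ⟨r, hr0, hrδ⟩ : ∃ r : ℝ, 0 < r ∧ 2 * r < δ := ⟨δ / 3, by positivity, by linarith⟩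
  have hS : IsCompact (Metric.closedBall q₀ δ) := isCompact_closedBall q₀ δ
  have hrS : Metric.closedBall q₀ r ⊆ Metric.closedBall q₀ δ :=
    Metric.closedBall_subset_closedBall (by linarith)
  obtain ⟨h, hh, hr, s, hs0, hsr, hs⟩ := exists_profile hr0
  obtain ⟨u, hu⟩ : ∃ u : EuclideanSpace ℝ (Fin n), ‖u‖ = 1 :=
    ⟨EuclideanSpace.single ⟨0, by omega⟩ 1, by simp⟩
  obtain ⟨c, hc⟩ : ∃ c : EuclideanSpace ℝ (Fin n) →L[ℝ] ℝ, ‖c‖ = 1 :=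
    ⟨innerSL ℝ u, by rw [innerSL_apply_norm, hu]⟩
  -- the differential of `f k` is `k • c` near the projection of the support of the rotations
  choose f hf hfS hfc using fun k : ℕ ↦ exists_eq_linear_near_ball hr0 hrδ q₀ ((k : ℝ) • c)
  let R (k : ℕ) : SupportedFlow (Metric.closedBall q₀ δ) :=
    rotation h hh (q₀, (k : ℝ) • c) hr hr0.le hrS
  let X (k : ℕ) (G : SupportedFlow (Metric.closedBall q₀ δ)) :=
    translate hS.isClosed (f k) (hf k) (hfS k) G
  let toG (F : SupportedFlow (Metric.closedBall q₀ δ)) : cotangentHamiltonianDiffeos n N :=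
    ⟨(F.toHamiltonianPath hS hδt).timeOne, F.toHamiltonianPath hS hδt, rfl⟩
  have hidG (x : CotangentBundle n N) : (toG (trivial _)).1 x = x := chartExtendMap_id x
  have hR0 : R 0 = rotation h hh (q₀, 0) hr hr0.le hrS := by simp [R]
  have hconst (k : ℕ) : d (toG (trivial _)) (toG (R 0)) = d (toG (trivial _)) (toG (R k)) := by
    refine hd.dist_eq_of_conj (χ := toG (X k (trivial _))) (ψ := toG (X k (R 0))) hidG
      (timeOne_comp hS hδt fun y ↦ rfl) (timeOne_comp hS hδt fun y ↦ ?_)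
    rw [hR0]
    exact translate_rotation hS.isClosed (hf k) (hfS k) hh hr hr0.le hrS (hfc k) y
  -- the Hamiltonians of `R k` converge to zero, since their supports escape to infinity
  have htends : Filter.Tendsto (fun k ↦ (R k).toHamiltonianPath hS hδt) Filter.atTop
      (𝓝 ((trivial _).toHamiltonianPath hS hδt)) := by
    refine tendsto_toHamiltonianPath hS hδt R fun C ↦ ?_
    filter_upwards [Filter.eventually_ge_atTop ⌈C + r⌉₊] with k hk t y hy
    refine rotation_ham_eq_zero hh hr hr0.le hrS ?_ t hy
    rw [norm_smul, hc, mul_one, Real.norm_natCast]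
    exact Nat.ceil_le.1 hk
  have hlim : Filter.Tendsto (fun k ↦ d (toG (trivial _)) (toG (R k))) Filter.atTop
      (𝓝 (d (toG (trivial _)) (toG (trivial _)))) := hcont.tendsto_dist _ htends
  have hzero : d (toG (trivial _)) (toG (R 0)) = 0 := by
    rw [← (hd.eq_zero_iff (toG (trivial _)) (toG (trivial _))).2 rfl]
    exact tendsto_nhds_unique (tendsto_const_nhds.congr hconst) hlim
  have heq := (hd.eq_zero_iff _ _).1 hzero
  -- the rotation `R 0` moves the point `(q₀ + v, 0)` to `(q₀ - v, 0)`
  let v : EuclideanSpace ℝ (Fin n) := Real.sqrt s • u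
  have hv : ‖v‖ = Real.sqrt s := by simp [v, norm_smul, hu, abs_of_nonneg]
  have hfix := (R 0).flow_eq_self_of_timeOne hS hδt
    (fun x ↦ congr(($heq).1 x).symm.trans (hidG x)) (q₀ + v, 0)
    (hrS (by simpa [hv] using Real.sqrt_le_iff.2 ⟨hr0.le, hsr.le⟩))
  rw [hR0, rotation_flow_one_eq hh hr hr0.le hrS v (by rwa [hv, Real.sq_sqrt hs0.le])] at hfix
  have h4 : q₀ - v = q₀ + v := congr(Prod.fst $hfix)
  have h5 : v = 0 := by
    have h6 : (q₀ + v) - (q₀ - v) = 0 := sub_eq_zero.2 h4.symm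
    rw [add_sub_sub_cancel, ← two_smul ℝ] at h6
    exact (smul_eq_zero.1 h6).resolve_left two_ne_zero
  rw [h5, norm_zero] at hv
  exact (Real.sqrt_pos.2 hs0).ne hv
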